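/- Let $(\Omega,\Sigma,\mu)$ be a finite measure space and let $X$ be a real Banach space such that $L_1(\Sigma,X)=L_1(\Omega,\Sigma,\mu;X)$ (Bochner integrable functions) is $L$-embedded, i.e. the canonical image of $L_1(\Sigma,X)$ in its bidual is the range of a bounded linear projection $P$ on $L_1(\Sigma,X)^{**}$ with $\|z\|=\|Pz\|+\|z-Pz\|$ for all $z\in L_1(\Sigma,X)^{**}$. Let $(\Sigma_n)_n$ be an increasing sequence of sub-$\sigma$-algebras of $\Sigma$ and let $\Sigma_\infty$ be the $\sigma$-algebra generated by $\bigcup_n\Sigma_n$. For a sub-$\sigma$-algebra $\Sigma'\subseteq\Sigma$, regard $L_1(\Sigma',X)$ as a subspace of $L_1(\Sigma,X)$. Let $F\subseteq L_1(\Sigma,X)$ be nonempty, closed and bounded, and let $\ell_\infty(F)$ be the set of all bounded functions $\varphi:F\to\mathbb{R}_{\ge 0}$, with the coordinatewise order and the supremum norm. Let $f:\ell_\infty(F)\to\mathbb{R}_{\ge 0}$ be continuous, strictly monotone ($\varphi_1\le\varphi_2$ and $\varphi_1\ne\varphi_2$ imply $f(\varphi_1)<f(\varphi_2)$) and coercive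 ($f(\varphi)\to\infty$ as $\|\varphi\|_\infty\to\infty$). For $z\in L_1(\Sigma,X)^{**}$ put $r_f(z,F)=f\big((\|z-a\|)_{a\in F}\big)$, where $L_1(\Sigma,X)$ is canonically embedded in $L_1(\Sigma,X)^{**}$, and assume that $r_f(\cdot,F):L_1(\Sigma,X)^{**}\to\mathbb{R}_{\ge 0}$ is $w^*$-lower semicontinuous. For a subspace $Y$ of $L_1(\Sigma,X)$ let $\mathrm{rad}_Y^f(F)=\inf_{y\in Y}r_f(y,F)$ and $\mathrm{Cent}_Y^f(F)=\{y\in Y: r_f(y,F)=\mathrm{rad}_Y^f(F)\}$. Suppose that for each $n$ there is given $f_n\in L_1(\Sigma_n,X)$ with $r_f(f_n,F)=\mathrm{rad}^f_{L_1(\Sigma_n,X)}(F)$. Then the set $\{f_n:n\in\mathbb{N}\}$ is relatively weakly compact in $L_1(\Sigma,X)$, and every weak limit point (weak cluster point) of the sequence $(f_n)$ belongs to $\mathrm{Cent}^f_{L_1(\Sigma_\infty,X)}(F)$. -/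

import Mathlib

open Set Filter Topology MeasureTheory
open scoped ENNReal NNReal

/-- The set `ℓ_∞(ι)` of all bounded functions `ι → ℝ_{≥ 0}`, i.e. the nonnegative cone of Mathlib's
real Banach space `ℓ^∞(ι)`, with the metric and topology of the supremum norm. -/
abbrev EllInfNonneg (ι : Type*) : Type _ :=
  {φ : lp (fun _ : ι => ℝ) ∞ // ∀ i, 0 ≤ φ i}

/-- Strict monotonicity of `f : ℓ_∞(ι) → ℝ_{≥ 0}` for the coordinatewise order. -/
def StrictlyMonotoneOnEllInf {ι : Type*} (f : EllInfNonneg ι → ℝ≥0) : Prop :=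
  ∀ φ₁ φ₂ : EllInfNonneg ι, (∀ i, φ₁.1 i ≤ φ₂.1 i) → φ₁ ≠ φ₂ → f φ₁ < f φ₂

/-- Coercivity: `f φ → ∞` as `‖φ‖_∞ → ∞`. -/
def CoerciveOnEllInf {ι : Type*} (f : EllInfNonneg ι → ℝ≥0) : Prop :=
  Tendsto f (comap (fun φ : EllInfNonneg ι => ‖φ.1‖) atTop) atTop

theorem memlp_infty_norm_sub {ι Z : Type*} [NormedAddCommGroup Z] (c : ι → Z)
    (hc : Bornology.IsBounded (range c)) (z : Z) :
    Memℓp (fun i => ‖z - c i‖ : ι → ℝ) ∞ := by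
  obtain ⟨C, hC⟩ := hc.exists_norm_le
  refine memℓp_infty ⟨‖z‖ + C, ?_⟩
  rintro _ ⟨i, rfl⟩
  have h1 := hC (c i) ⟨i, rfl⟩
  have h2 := norm_sub_le z (c i)
  simp only [norm_norm]
  linarith

/-- The tuple `(‖z - c i‖)_i` in `ℓ_∞(ι)`, for a bounded family `c` of points. -/
noncomputable def distTuple {ι Z : Type*} [NormedAddCommGroup Z] (c : ι → Z)
    (hc : Bornology.IsBounded (range c)) (z : Z) : EllInfNonneg ι :=
  ⟨⟨fun i => ‖z - c i‖, memlp_infty_norm_sub c hc z⟩, fun _ => norm_nonneg _⟩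

section Centers

variable {E : Type*} [NormedAddCommGroup E] [NormedSpace ℝ E]

theorem isBounded_range_val {E : Type*} [NormedAddCommGroup E] {F : Set E} (hF : Bornology.IsBounded F) :
    Bornology.IsBounded (range (fun a : F => (a : E))) := by
  simpa using hF

theorem isBounded_range_bidual {F : Set E} (hF : Bornology.IsBounded F) :
    Bornology.IsBounded
      (range (fun a : F => NormedSpace.inclusionInDoubleDual ℝ E (a : E))) := by
  obtain ⟨C, hC⟩ := hF.exists_norm_le
  refine isBounded_iff_forall_norm_le.2 ⟨C, ?_⟩
  rintro _ ⟨a, rfl⟩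
  exact (NormedSpace.double_dual_bound ℝ E (a : E)).trans (hC a a.2)

/-- `r_f(x, F) = f((‖x - a‖)_{a ∈ F})` for `x ∈ E`. -/
noncomputable def rFun {F : Set E} (hF : Bornology.IsBounded F) (f : EllInfNonneg F → ℝ≥0)
    (x : E) : ℝ≥0 :=
  f (distTuple (fun a : F => (a : E)) (isBounded_range_val hF) x)

/-- `r_f(z, F) = f((‖z - a‖)_{a ∈ F})` for `z ∈ E**`, where `F ⊆ E` is canonically embedded
in `E**`. -/
noncomputable def rFunBidual {F : Set E} (hF : Bornology.IsBounded F)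
    (f : EllInfNonneg F → ℝ≥0) (z : StrongDual ℝ (StrongDual ℝ E)) : ℝ≥0 :=
  f (distTuple (fun a : F => NormedSpace.inclusionInDoubleDual ℝ E (a : E))
    (isBounded_range_bidual hF) z)

/-- `rad_Y^f(F) = inf_{y ∈ Y} r_f(y, F)`. -/
noncomputable def fRad {F : Set E} (hF : Bornology.IsBounded F) (f : EllInfNonneg F → ℝ≥0)
    (Y : Submodule ℝ E) : ℝ≥0 :=
  ⨅ y : Y, rFun hF f (y : E)

/-- `Cent_Y^f(F)`, the set of points of `Y` at which the infimum `rad_Y^f(F)` is attained. -/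
def fCent {F : Set E} (hF : Bornology.IsBounded F) (f : EllInfNonneg F → ℝ≥0)
    (Y : Submodule ℝ E) : Set E :=
  {y | y ∈ Y ∧ rFun hF f y = fRad hF f Y}

end Centers

/-- `P : Z → Z` is a bounded linear projection with `‖z‖ = ‖P z‖ + ‖z - P z‖` for all `z`. -/
def IsBoundedLProjection {Z : Type*} [NormedAddCommGroup Z] [NormedSpace ℝ Z]
    (P : Z →L[ℝ] Z) : Prop :=
  IsLprojection Z P

/-- `E` is `L`-embedded: its canonical image in `E**` is the range of an `L`-projection
on `E**`. -/
def IsLEmbedded (E : Type*) [NormedAddCommGroup E] [NormedSpace ℝ E] : Prop :=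
  ∃ P : StrongDual ℝ (StrongDual ℝ E) →L[ℝ] StrongDual ℝ (StrongDual ℝ E),
    IsBoundedLProjection (Z := StrongDual ℝ (StrongDual ℝ E)) P ∧
      range P = range (NormedSpace.inclusionInDoubleDual ℝ E)

/-! Let `z` be a w*-cluster point of the minimizers in the bidual. The radii decrease in `n`, so
w*-lower semicontinuity bounds `r_f(z)` by all of them, hence by the radius over `L_1(Σ_∞)`, in
which the union of the `L_1(Σ_n)` is dense.

The conditional expectation `T` onto `Σ_∞` is a contraction fixing every minimizer, so `T**` fixes
`z`, and the L-norm identity forces `T` to fix `P z`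
(`IsBoundedLProjection.fixed_of_bidualMap_fixed`); thus `P z` lies in `L_1(Σ_∞)`. If `P z ≠ z`, all
distances to `F` drop strictly on passing to `P z`, and strict monotonicity puts `r_f(P z)` below
the radius, which is absurd. So `z = P z` is a center.

Coercivity bounds the sequence. As all its w*-cluster points lie in the space itself, it is
relatively weakly compact. -/

/-- The bidual `T** : E** → E**` of an operator `T`. -/
noncomputable def bidualMap {E : Type*} [NormedAddCommGroup E] [NormedSpace ℝ E]
    (T : E →L[ℝ] E) (z : StrongDual ℝ (StrongDual ℝ E)) : StrongDual ℝ (StrongDual ℝ E) :=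
  z.comp (ContinuousLinearMap.compL ℝ E E ℝ |>.flip T)

/-! ### Bidual operators and L-projections -/

section Bidual

variable {E : Type*} [NormedAddCommGroup E] [NormedSpace ℝ E]

theorem bidualMap_apply (T : E →L[ℝ] E) (z : StrongDual ℝ (StrongDual ℝ E))
    (φ : StrongDual ℝ E) : bidualMap T z φ = z (φ.comp T) := rfl

theorem bidualMap_sub (T : E →L[ℝ] E) (z w : StrongDual ℝ (StrongDual ℝ E)) :
    bidualMap T (z - w) = bidualMap T z - bidualMap T w := rfl

theorem bidualMap_inclusion (T : E →L[ℝ] E) (x : E) :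
    bidualMap T (NormedSpace.inclusionInDoubleDual ℝ E x) =
      NormedSpace.inclusionInDoubleDual ℝ E (T x) := rfl

theorem norm_bidualMap_le {T : E →L[ℝ] E} (hT : ‖T‖ ≤ 1) (z : StrongDual ℝ (StrongDual ℝ E)) :
    ‖bidualMap T z‖ ≤ ‖z‖ := by
  refine ContinuousLinearMap.opNorm_le_bound _ (norm_nonneg z) fun φ => ?_
  rw [bidualMap_apply]
  refine (z.le_opNorm _).trans (mul_le_mul_of_nonneg_left ?_ (norm_nonneg z))
  calc ‖φ.comp T‖ ≤ ‖φ‖ * ‖T‖ := φ.opNorm_comp_le T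
    _ ≤ ‖φ‖ := mul_le_of_le_one_right (norm_nonneg φ) hT

theorem norm_inclusionInDoubleDual (x : E) :
    ‖NormedSpace.inclusionInDoubleDual ℝ E x‖ = ‖x‖ :=
  (NormedSpace.inclusionInDoubleDualLi (E := E) ℝ).norm_map x

variable {P : StrongDual ℝ (StrongDual ℝ E) →L[ℝ] StrongDual ℝ (StrongDual ℝ E)}

theorem IsBoundedLProjection.norm_eq (hP : IsBoundedLProjection (Z := StrongDual ℝ (StrongDual ℝ E)) P)
    (z : StrongDual ℝ (StrongDual ℝ E)) : ‖z‖ = ‖P z‖ + ‖z - P z‖ :=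
  hP.Lnorm z

theorem IsBoundedLProjection.apply_apply (hP : IsBoundedLProjection (Z := StrongDual ℝ (StrongDual ℝ E)) P)
    (z : StrongDual ℝ (StrongDual ℝ E)) : P (P z) = P z :=
  DFunLike.congr_fun hP.proj.eq z

theorem IsBoundedLProjection.apply_inclusion (hP : IsBoundedLProjection (Z := StrongDual ℝ (StrongDual ℝ E)) P)
    (hr : range P = range (NormedSpace.inclusionInDoubleDual ℝ E)) (x : E) :
    P (NormedSpace.inclusionInDoubleDual ℝ E x) = NormedSpace.inclusionInDoubleDual ℝ E x := by
  obtain ⟨w, hw⟩ : NormedSpace.inclusionInDoubleDual ℝ E x ∈ range P := hr ▸ mem_range_self x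
  rw [← hw, hP.apply_apply]

/-- `P` fixes the canonical image, so the two L-summands of `z - a` are `P z - a` and `z - P z`; the
second does not depend on `a`. -/
theorem IsBoundedLProjection.norm_sub_inclusion (hP : IsBoundedLProjection (Z := StrongDual ℝ (StrongDual ℝ E)) P)
    (hr : range P = range (NormedSpace.inclusionInDoubleDual ℝ E))
    (z : StrongDual ℝ (StrongDual ℝ E)) (a : E) :
    ‖z - NormedSpace.inclusionInDoubleDual ℝ E a‖ =
      ‖P z - NormedSpace.inclusionInDoubleDual ℝ E a‖ + ‖z - P z‖ := by
  have h : P (z - NormedSpace.inclusionInDoubleDual ℝ E a) =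
      P z - NormedSpace.inclusionInDoubleDual ℝ E a :=
    (map_sub P z _).trans (congrArg (P z - ·) (hP.apply_inclusion hr a))
  rw [hP.norm_eq, h]
  exact congrArg (‖P z - NormedSpace.inclusionInDoubleDual ℝ E a‖ + ‖·‖)
    (sub_sub_sub_cancel_right z (P z) _)

/-- If a contraction `T` on an `L`-embedded space fixes `z ∈ E**`, it also fixes `P z`. -/
theorem IsBoundedLProjection.fixed_of_bidualMap_fixed (hP : IsBoundedLProjection (Z := StrongDual ℝ (StrongDual ℝ E)) P)
    (hr : range P = range (NormedSpace.inclusionInDoubleDual ℝ E)) {T : E →L[ℝ] E} (hT : ‖T‖ ≤ 1)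
    {z : StrongDual ℝ (StrongDual ℝ E)} (hz : bidualMap T z = z) {x : E}
    (hx : P z = NormedSpace.inclusionInDoubleDual ℝ E x) : T x = x := by
  have h1 : bidualMap T (z - P z) = z - NormedSpace.inclusionInDoubleDual ℝ E (T x) := by
    rw [bidualMap_sub, hz, hx, bidualMap_inclusion]
  have h2 := norm_bidualMap_le hT (z - P z)
  have hsub : ‖NormedSpace.inclusionInDoubleDual ℝ E x -
      NormedSpace.inclusionInDoubleDual ℝ E (T x)‖ = ‖x - T x‖ :=
    (congrArg norm (map_sub _ x (T x)).symm).trans (norm_inclusionInDoubleDual _)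
  rw [h1, hP.norm_sub_inclusion hr, hx, hsub] at h2
  -- `h2` now reads `‖x - T x‖ + ‖z - P z‖ ≤ ‖z - P z‖`, up to order of summands.
  have h3 : ‖x - T x‖ = 0 := le_antisymm (by linarith) (norm_nonneg _)
  exact (sub_eq_zero.1 (norm_eq_zero.1 h3)).symm

end Bidual

/-! ### Radii, centers and w*-cluster points -/

section RestrictedCenters

variable {E : Type*} [NormedAddCommGroup E] [NormedSpace ℝ E] {F : Set E}
  (hF : Bornology.IsBounded F) (f : EllInfNonneg F → ℝ≥0)

theorem distTuple_apply {ι Z : Type*} [NormedAddCommGroup Z] (c : ι → Z)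
    (hc : Bornology.IsBounded (range c)) (z : Z) (i : ι) :
    (distTuple c hc z).1 i = ‖z - c i‖ := rfl

theorem rFunBidual_inclusion (x : E) :
    rFunBidual hF f (NormedSpace.inclusionInDoubleDual ℝ E x) = rFun hF f x := by
  unfold rFunBidual rFun
  congr 1
  refine Subtype.ext (lp.ext (funext fun a => ?_))
  rw [distTuple_apply, distTuple_apply, ← map_sub, norm_inclusionInDoubleDual]

theorem lipschitzWith_distTuple {ι Z : Type*} [NormedAddCommGroup Z] (c : ι → Z)
    (hc : Bornology.IsBounded (range c)) : LipschitzWith 1 (distTuple c hc) := by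
  refine LipschitzWith.of_dist_le_mul fun x y => ?_
  rw [NNReal.coe_one, one_mul, Subtype.dist_eq, dist_eq_norm]
  refine lp.norm_le_of_forall_le dist_nonneg fun i => ?_
  rw [lp.coeFn_sub, Pi.sub_apply, distTuple_apply, distTuple_apply, dist_eq_norm]
  exact (abs_norm_sub_norm_le _ _).trans_eq (by rw [sub_sub_sub_cancel_right])

variable {f}

omit [NormedSpace ℝ E] in
theorem continuous_rFun (hf : Continuous f) : Continuous (rFun hF f) :=
  hf.comp (lipschitzWith_distTuple _ _).continuous

theorem fRad_le (Y : Submodule ℝ E) {y : E} (hy : y ∈ Y) : fRad hF f Y ≤ rFun hF f y :=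
  ciInf_le' (fun y : Y => rFun hF f (y : E)) ⟨y, hy⟩

theorem le_fRad_closure (hf : Continuous f) {Y : ℕ → Submodule ℝ E} {Z : Submodule ℝ E}
    (hZ : (Z : Set E) ⊆ closure (⋃ n, (Y n : Set E))) {c : ℝ≥0}
    (hc : ∀ n, c ≤ fRad hF f (Y n)) : c ≤ fRad hF f Z := by
  refine le_ciInf fun y => ?_
  have hcl : IsClosed {x : E | c ≤ rFun hF f x} :=
    isClosed_le continuous_const (continuous_rFun hF hf)
  refine closure_minimal ?_ hcl (hZ y.2)
  exact iUnion_subset fun n x hx => (hc n).trans (fRad_le hF (Y n) hx)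

omit [NormedSpace ℝ E] in
-- A single coordinate `‖x - a‖` is at most the sup norm of the tuple, so large `x` forces large
-- `r_f`.
theorem isBounded_of_rFun_le (hFne : F.Nonempty) (hf : CoerciveOnEllInf f) (C : ℝ≥0) :
    Bornology.IsBounded {x : E | rFun hF f x ≤ C} := by
  have h := hf.eventually (eventually_gt_atTop C)
  rw [eventually_comap] at h
  obtain ⟨R, hR⟩ := eventually_atTop.1 h
  obtain ⟨a, ha⟩ := hFne
  refine (Metric.isBounded_closedBall (x := a) (r := R)).subset fun x hx => ?_
  by_contra hxa
  rw [Metric.mem_closedBall, not_le, dist_eq_norm] at hxa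
  refine (hR _ ?_ _ rfl).not_ge hx
  refine hxa.le.trans ?_
  have := lp.norm_apply_le_norm ENNReal.top_ne_zero
    (distTuple (fun a : F => (a : E)) (isBounded_range_val hF) x).1 ⟨a, ha⟩
  rwa [distTuple_apply, norm_norm] at this

theorem IsBoundedLProjection.rFunBidual_lt
    {P : StrongDual ℝ (StrongDual ℝ E) →L[ℝ] StrongDual ℝ (StrongDual ℝ E)}
    (hP : IsBoundedLProjection (Z := StrongDual ℝ (StrongDual ℝ E)) P)
    (hr : range P = range (NormedSpace.inclusionInDoubleDual ℝ E))
    (hFne : F.Nonempty) (hf : StrictlyMonotoneOnEllInf f) {z : StrongDual ℝ (StrongDual ℝ E)}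
    (hz : P z ≠ z) : rFunBidual hF f (P z) < rFunBidual hF f z := by
  have hpos : 0 < ‖z - P z‖ := norm_pos_iff.2 (sub_ne_zero.2 hz.symm)
  refine hf _ _ (fun a => ?_) fun h => ?_
  · rw [distTuple_apply, distTuple_apply, hP.norm_sub_inclusion hr z]
    exact le_add_of_nonneg_right hpos.le
  · obtain ⟨a, ha⟩ := hFne
    have h' := congrArg (fun φ : EllInfNonneg F => φ.1 ⟨a, ha⟩) h
    simp only [distTuple_apply] at h'
    rw [hP.norm_sub_inclusion hr z] at h'
    linarith

/-- A `w*`-cluster point in `E**` of minimizers over an increasing sequence of subspaces is a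
minimizer over the closure `Z` of their union, provided `Z` is the range of a contractive
projection. -/
theorem exists_mem_fCent_of_mapClusterPt (hL : IsLEmbedded E) (hFne : F.Nonempty)
    (hfcont : Continuous f) (hfmono : StrictlyMonotoneOnEllInf f)
    (hflsc : LowerSemicontinuous
      (fun z : WeakDual ℝ (StrongDual ℝ E) => rFunBidual hF f (WeakDual.toStrongDual z)))
    {Y : ℕ → Submodule ℝ E} (hY : Monotone Y) {Z : Submodule ℝ E} (hYZ : ∀ n, Y n ≤ Z)
    (hZ : (Z : Set E) ⊆ closure (⋃ n, (Y n : Set E)))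
    {T : E →L[ℝ] E} (hT : ‖T‖ ≤ 1) (hTmem : ∀ x, T x ∈ Z) (hTfix : ∀ x ∈ Z, T x = x)
    {g : ℕ → E} (hgmem : ∀ n, g n ∈ Y n) (hg : ∀ n, fRad hF f (Y n) = rFun hF f (g n))
    {z : WeakDual ℝ (StrongDual ℝ E)}
    (hz : MapClusterPt z atTop
      (fun n => NormedSpace.inclusionInDoubleDualWeak ℝ E (toWeakSpace ℝ E (g n)))) :
    ∃ x ∈ fCent hF f Z,
      z = NormedSpace.inclusionInDoubleDualWeak ℝ E (toWeakSpace ℝ E x) := by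
  obtain ⟨P, hP, hr⟩ := hL
  set z' : StrongDual ℝ (StrongDual ℝ E) := WeakDual.toStrongDual z with hz'
  obtain ⟨x, hx⟩ : P z' ∈ range (NormedSpace.inclusionInDoubleDual ℝ E) := hr ▸ mem_range_self z'
  have hfix : bidualMap T z' = z' := by
    refine ContinuousLinearMap.ext fun φ => ?_
    have hcl : IsClosed {w : WeakDual ℝ (StrongDual ℝ E) | w (φ.comp T) = w φ} :=
      isClosed_eq (WeakDual.eval_continuous _) (WeakDual.eval_continuous _)
    refine hcl.mem_of_mapClusterPt hz (Eventually.of_forall fun n => ?_)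
    change φ (T (g n)) = φ (g n)
    rw [hTfix _ (hYZ n (hgmem n))]
  have hxZ : x ∈ Z := hP.fixed_of_bidualMap_fixed hr hT hfix hx.symm ▸ hTmem x
  have hanti : Antitone fun n => fRad hF f (Y n) := fun m n hmn => by
    change fRad hF f (Y n) ≤ fRad hF f (Y m)
    rw [hg m]
    exact fRad_le hF _ (hY hmn (hgmem m))
  have hle : rFunBidual hF f z' ≤ fRad hF f Z := by
    -- For `c < r_f(z)`, semicontinuity gives `c < r_f(g m)` for some `m ≥ n`; antitonicity carries
    -- the bound back to `n`.
    refine le_of_forall_lt_imp_le_of_dense fun c hc => le_fRad_closure hF hfcont hZ fun n => ?_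
    obtain ⟨m, hm, hcm⟩ := (hz.frequently (hflsc z c hc)).forall_exists_of_atTop n
    refine le_trans ?_ (hanti hm)
    change c ≤ fRad hF f (Y m)
    rw [hg m, ← rFunBidual_inclusion]
    exact le_of_lt hcm
  have hPz : P z' = z' := by
    by_contra hne
    have h1 := hP.rFunBidual_lt hF hr hFne hfmono hne
    rw [← hx, rFunBidual_inclusion] at h1
    exact (h1.trans_le hle).not_ge (fRad_le hF Z hxZ)
  have hxz : NormedSpace.inclusionInDoubleDual ℝ E x = z' := hx.trans hPz
  refine ⟨x, ⟨hxZ, le_antisymm ?_ (fRad_le hF Z hxZ)⟩, ?_⟩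
  · rwa [← rFunBidual_inclusion, hxz]
  · exact (WeakDual.toStrongDual_inj _ _).1 hxz.symm

end RestrictedCenters

/-! ### Closures of sequences -/

section WeakCompactness

/-- A limit of the range that is not a cluster point avoids the closure of some tail, so it lies in
a finite, hence closed, initial segment. -/
theorem closure_range_subset_of_mapClusterPt {S : Type*} [TopologicalSpace S] [T1Space S]
    {u : ℕ → S} {A : Set S} (hu : range u ⊆ A) (h : ∀ z, MapClusterPt z atTop u → z ∈ A) :
    closure (range u) ⊆ A := by
  intro z hz
  by_cases hcl : MapClusterPt z atTop u
  · exact h z hcl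
  rw [mapClusterPt_atTop_iff_forall_mem_closure] at hcl
  push Not at hcl
  obtain ⟨N, hN⟩ := hcl
  have hsplit : range u = u '' Iio N ∪ u '' Ici N := by
    rw [← image_union, Iio_union_Ici, image_univ]
  rw [hsplit, closure_union, ((finite_Iio N).image u).isClosed.closure_eq] at hz
  exact hu (image_subset_range u _ (hz.resolve_right hN))

end WeakCompactness

/-! ### Approximation by sets from the `𝓢 n` -/

section MeasurableApproximation

theorem isSetAlgebra_iUnion_measurableSet {Ω : Type*} {𝓢 : ℕ → MeasurableSpace Ω}
    (h𝓢 : Monotone 𝓢) : IsSetAlgebra {s | ∃ n, MeasurableSet[𝓢 n] s} where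
  empty_mem := ⟨0, @MeasurableSet.empty _ (𝓢 0)⟩
  compl_mem := fun _ ⟨n, hn⟩ => ⟨n, @MeasurableSet.compl _ _ (𝓢 n) hn⟩
  union_mem := fun _ _ ⟨n, hn⟩ ⟨k, hk⟩ => ⟨max n k, @MeasurableSet.union _ (𝓢 (max n k)) _ _
    (h𝓢 (le_max_left n k) _ hn) (h𝓢 (le_max_right n k) _ hk)⟩

theorem measureDense_iUnion_measurableSet {Ω : Type*} {𝓢 : ℕ → MeasurableSpace Ω}
    (h𝓢 : Monotone 𝓢) {m : MeasurableSpace Ω} (hm : m = ⨆ n, 𝓢 n) (ν : Measure Ω)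
    [IsFiniteMeasure ν] : ν.MeasureDense {s | ∃ n, MeasurableSet[𝓢 n] s} :=
  .of_generateFrom_isSetAlgebra_finite ν (isSetAlgebra_iUnion_measurableSet h𝓢)
    (hm.trans (MeasurableSpace.measurableSpace_iSup_eq 𝓢))

theorem exists_measurableSet_symmDiff_lt {Ω : Type*} {𝓢 : ℕ → MeasurableSpace Ω}
    (h𝓢 : Monotone 𝓢) {mΩ : MeasurableSpace Ω} {μ : Measure Ω} [IsFiniteMeasure μ]
    (h𝓢le : ∀ n, 𝓢 n ≤ mΩ) {s : Set Ω} (hs : MeasurableSet[⨆ n, 𝓢 n] s) {ε : ℝ} (hε : 0 < ε) :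
    ∃ n t, MeasurableSet[𝓢 n] t ∧ μ (symmDiff s t) < ENNReal.ofReal ε := by
  have hm : ⨆ n, 𝓢 n ≤ mΩ := iSup_le h𝓢le
  have hd := measureDense_iUnion_measurableSet h𝓢 rfl (μ.trim hm)
  obtain ⟨t, ⟨n, ht⟩, hst⟩ := @Measure.MeasureDense.approx Ω (⨆ n, 𝓢 n) (μ.trim hm) _ hd s hs
    (measure_ne_top _ _) ε hε
  exact ⟨n, t, ht, (le_trim hm).trans_lt hst⟩

theorem lpMeas_mono {Ω X : Type*} {m m' mΩ : MeasurableSpace Ω} {μ : Measure Ω}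
    [NormedAddCommGroup X] [NormedSpace ℝ X] (h : m ≤ m') :
    lpMeas X ℝ m 1 μ ≤ lpMeas X ℝ m' 1 μ := fun _ hg =>
  mem_lpMeas_iff_aestronglyMeasurable.2 ((mem_lpMeas_iff_aestronglyMeasurable.1 hg).mono h)

end MeasurableApproximation

/-! ### Conditional expectation and density in `L_1(Σ_∞)` -/

section ConditionalExpectation

variable {Ω X : Type*} [mΩ : MeasurableSpace Ω] {μ : Measure Ω} [IsFiniteMeasure μ]
  [NormedAddCommGroup X] [NormedSpace ℝ X]

theorem norm_condExpL1CLM_le [CompleteSpace X] {m : MeasurableSpace Ω} (hm : m ≤ mΩ) :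
    ‖condExpL1CLM X hm μ‖ ≤ 1 :=
  L1.norm_setToL1_le _ zero_le_one

theorem lpMeas_iSup_subset_closure {𝓢 : ℕ → MeasurableSpace Ω} (h𝓢 : Monotone 𝓢)
    (h𝓢le : ∀ n, 𝓢 n ≤ mΩ) :
    (lpMeas X ℝ (⨆ n, 𝓢 n) 1 μ : Set (Lp X 1 μ)) ⊆
      closure (⋃ n, (lpMeas X ℝ (𝓢 n) 1 μ : Set (Lp X 1 μ))) := by
  have hm : ⨆ n, 𝓢 n ≤ mΩ := iSup_le h𝓢le
  have hmono : Monotone fun n => lpMeas X ℝ (𝓢 n) 1 μ := fun i j hij => lpMeas_mono (h𝓢 hij)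
  have hcoe : (⋃ n, (lpMeas X ℝ (𝓢 n) 1 μ : Set (Lp X 1 μ))) =
      ((⨆ n, lpMeas X ℝ (𝓢 n) 1 μ : Submodule ℝ (Lp X 1 μ)) : Set (Lp X 1 μ)) :=
    (Submodule.coe_iSup_of_directed _ hmono.directed_le).symm
  intro g hg
  refine Lp.induction_stronglyMeasurable hm ENNReal.one_ne_top
    (fun g => g ∈ closure (⋃ n, (lpMeas X ℝ (𝓢 n) 1 μ : Set (Lp X 1 μ)))) ?_ ?_ ?_ g
    (mem_lpMeas_iff_aestronglyMeasurable.1 hg)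
  · intro c s hs hμs
    rw [Lp.simpleFunc.coe_indicatorConst]
    refine Metric.mem_closure_iff.2 fun ε hε => ?_
    -- The `+ 1` covers `c = 0`.
    have hc : 0 < ‖c‖ + 1 := by positivity
    obtain ⟨n, t, ht, hst⟩ := exists_measurableSet_symmDiff_lt (μ := μ) h𝓢 h𝓢le hs (div_pos hε hc)
    refine ⟨indicatorConstLp 1 (h𝓢le n _ ht) (measure_ne_top μ t) c, mem_iUnion.2 ⟨n,
      mem_lpMeas_indicatorConstLp (h𝓢le n) ht (measure_ne_top μ t)⟩, ?_⟩
    rw [dist_indicatorConstLp_eq_norm, norm_indicatorConstLp one_ne_zero ENNReal.one_ne_top]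
    have hst' : μ.real (symmDiff s t) < ε / (‖c‖ + 1) :=
      ENNReal.toReal_lt_of_lt_ofReal hst
    rw [lt_div_iff₀ hc] at hst'
    simp only [ENNReal.toReal_one, div_one, Real.rpow_one]
    nlinarith [measureReal_nonneg (μ := μ) (s := symmDiff s t)]
  · intro u v hu hv _ _ _ hPu hPv
    rw [hcoe] at hPu hPv ⊢
    exact (Submodule.topologicalClosure _).add_mem hPu hPv
  · exact isClosed_closure.preimage continuous_subtype_val

end ConditionalExpectation

theorem theorem3p8 {Ω X : Type*} [mΩ : MeasurableSpace Ω] (μ : Measure Ω) [IsFiniteMeasure μ]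
    [NormedAddCommGroup X] [NormedSpace ℝ X] [CompleteSpace X]
    (hL : IsLEmbedded (Lp X 1 μ))
    (𝓢 : ℕ → MeasurableSpace Ω) (h𝓢mono : Monotone 𝓢) (h𝓢le : ∀ n, 𝓢 n ≤ mΩ)
    (F : Set (Lp X 1 μ)) (hFne : F.Nonempty) (hFcl : IsClosed F) (hF : Bornology.IsBounded F)
    (f : EllInfNonneg F → ℝ≥0) (hfcont : Continuous f)
    (hfmono : StrictlyMonotoneOnEllInf f) (hfcoer : CoerciveOnEllInf f)
    (hflsc : LowerSemicontinuous
      (fun z : WeakDual ℝ (StrongDual ℝ (Lp X 1 μ)) => rFunBidual hF f (WeakDual.toStrongDual z)))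
    (g : ℕ → Lp X 1 μ) (hgmem : ∀ n, g n ∈ lpMeas X ℝ (𝓢 n) 1 μ)
    (hg : ∀ n, fRad hF f (lpMeas X ℝ (𝓢 n) 1 μ) = rFun hF f (g n)) :
    IsCompact (closure (range (fun n => toWeakSpace ℝ (Lp X 1 μ) (g n)))) ∧
      ∀ h : Lp X 1 μ,
        MapClusterPt (toWeakSpace ℝ (Lp X 1 μ) h) atTop
          (fun n => toWeakSpace ℝ (Lp X 1 μ) (g n)) →
        h ∈ fCent hF f (lpMeas X ℝ (⨆ n, 𝓢 n) 1 μ) := by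
  have hm : ⨆ n, 𝓢 n ≤ mΩ := iSup_le h𝓢le
  have key : ∀ z : WeakDual ℝ (StrongDual ℝ (Lp X 1 μ)),
      MapClusterPt z atTop (fun n => NormedSpace.inclusionInDoubleDualWeak ℝ (Lp X 1 μ)
        (toWeakSpace ℝ (Lp X 1 μ) (g n))) →
      ∃ x ∈ fCent hF f (lpMeas X ℝ (⨆ n, 𝓢 n) 1 μ),
        z = NormedSpace.inclusionInDoubleDualWeak ℝ (Lp X 1 μ) (toWeakSpace ℝ (Lp X 1 μ) x) :=
    fun z hz => exists_mem_fCent_of_mapClusterPt hF hL hFne hfcont hfmono hflsc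
      (fun i j hij => lpMeas_mono (h𝓢mono hij)) (fun n => lpMeas_mono (le_iSup 𝓢 n))
      (lpMeas_iSup_subset_closure h𝓢mono h𝓢le) (norm_condExpL1CLM_le hm)
      (fun x => mem_lpMeas_iff_aestronglyMeasurable.2 (aestronglyMeasurable_condExpL1CLM x))
      (fun x hx => condExpL1CLM_of_aestronglyMeasurable' x
        (mem_lpMeas_iff_aestronglyMeasurable.1 hx)) hgmem hg hz
  refine ⟨NormedSpace.isCompact_closure_of_isBounded ℝ _ _ ?_ ?_, fun h hh => ?_⟩
  · refine (isBounded_of_rFun_le hF hFne hfcoer (rFun hF f 0)).subset ?_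
    rintro x ⟨n, hn⟩
    obtain rfl : g n = x := (toWeakSpace ℝ (Lp X 1 μ)).injective hn
    -- `0` lies in every subspace, so `r_f(0)` bounds all the radii.
    exact (hg n).symm.trans_le (fRad_le hF _ (Submodule.zero_mem _))
  · rw [← range_comp]
    refine closure_range_subset_of_mapClusterPt ?_ fun z hz => ?_
    · rintro _ ⟨n, rfl⟩
      exact mem_range_self _
    · obtain ⟨x, -, rfl⟩ := key z hz
      exact mem_range_self _
  · obtain ⟨x, hx, hxh⟩ := key _ (hh.continuousAt_comp
      (NormedSpace.inclusionInDoubleDualWeak ℝ (Lp X 1 μ)).continuous.continuousAt)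
    have hxh' := (NormedSpace.isEmbedding_inclusionInDoubleDualWeak ℝ (Lp X 1 μ)).injective hxh
    rwa [(toWeakSpace ℝ (Lp X 1 μ)).injective hxh']
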